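/- Consider the following buffering problem. Time is divided into cycles $t=0,1,2,\dots$. In each cycle, first the fully processed packets leave the queue and each of them yields its profit (transmission); then finitely many unit-size packets may arrive, and the algorithm decides which of the buffered and newly arrived packets it keeps in its buffer, the others being lost (arrival); finally the algorithm may select one packet in its buffer, which receives one cycle of processing (processing). A packet $p$ has a work $w(p)\in\{W_0,\dots,W\}$, the number of processing cycles it needs, and a profit $v(p)\in\{1,\dots,V\}$. Both are either known upon arrival, or unknown upon arrival; in the latter case they are revealed to an online algorithm when $p$ is processed for the first time (this first cycle counts towards the work). At most $M$ unknown packets arrive in any single cycle. An input $\sigma$ is a finite arrival sequence of this kind (after which time continues without arrivals), and the throughput of an algorithm on $\sigma$ is the total profit of all packets that it transmits. A randomized online algorithm $\mathrm{Alg}$ with a buffer for $B$ packets bases each decision on its random bits, on the arrivals so far (without the characteristics of unknown packets), and on the characteristics revealed so far. Its competitive ratio against an optimal offline (clairvoyant) algorithm $\mathrm{OPT}_b$ with a buffer for $b$ packets is the infimum of all $c\in[0,\infty]$ such that $\mathrm{TP}(\mathrm{OPT}_b,\sigma)\le c\cdot\mathbb{E}[\mathrm{TP}(\mathrm{Alg},\sigma)]$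 for every input $\sigma$. Let $1\le W_0\le W$, $W\ge 2$, $V\ge 1$, $M\ge 1$ and $B\ge 2$ be integers, and let traffic be non-uniform, that is, $W_0<W$ or $V>1$. Then every randomized online algorithm with a buffer for $B$ packets has competitive ratio at least $$\frac{V(W-1)}{2W_0}\left[1-\left(1-\frac{1}{V(W-1)+1-W_0}\right)^{MW_0}\right]$$ against $\mathrm{OPT}_B$, and even against $\mathrm{OPT}_1$, an optimal offline algorithm whose buffer can store only a single packet. -/

import Mathlib

open MeasureTheory
open scoped ENNReal

namespace Buffering

/-! ### Packets and traffic -/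

/-- A unit-size packet: its required number of processing cycles, its profit, and whether these
characteristics are known upon arrival (a `K`-packet) or not (a `U`-packet). -/
structure Packet where
  work : ℕ
  profit : ℕ
  known : Bool

/-- What a queue management algorithm sees of an arriving packet: the pair (work, profit) of a
`K`-packet, and nothing for a `U`-packet. -/
def Packet.label (p : Packet) : Option (ℕ × ℕ) :=
  if p.known then some (p.work, p.profit) else none

/-- A finite input sequence: the `t`-th entry lists the packets arriving in cycle `t`. After the
last entry time goes on, without further arrivals. -/
abbrev Traffic := List (List Packet)

/-- The packets arriving in cycle `t`. -/
def arrivals (σ : Traffic) (t : ℕ) : List Packet := σ.getD t []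

/-- A packet is identified by its arrival cycle and its position among the arrivals of that
cycle. -/
abbrev PacketId := ℕ × ℕ

/-- The identifiers of the packets arriving in cycle `t`. -/
def arrivingIds (σ : Traffic) (t : ℕ) : Finset PacketId :=
  (Finset.range (arrivals σ t).length).image fun i => (t, i)

/-- The packet with a given identifier (the default value is never used for a packet of `σ`). -/
def packetAt (σ : Traffic) (p : PacketId) : Packet := (arrivals σ p.1).getD p.2 ⟨0, 0, true⟩

/-- Traffic in which all works lie in `{W₀, …, W}`, all profits lie in `{1, …, V}`, and at most `M`
`U`-packets arrive in any single cycle. -/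
def Admissible (W₀ W V M : ℕ) (σ : Traffic) : Prop :=
  ∀ cycle ∈ σ,
    (∀ p ∈ cycle, W₀ ≤ p.work ∧ p.work ≤ W ∧ 1 ≤ p.profit ∧ p.profit ≤ V) ∧
    cycle.countP (fun p => !p.known) ≤ M

/-! ### Dynamics of the queue -/

/-- The decision taken in one cycle: which of the buffered and newly arriving packets are to be in
the buffer after the arrival step (all others are dropped for good), and which buffered packet, if
any, is to be processed in the processing step. -/
structure Action where
  retain : Finset PacketId
  process : Option PacketId

/-- The state of the queue at the end of a cycle: the buffered packets, the number of processing
cycles that each packet has received so far, and the profit of the packets transmitted so far. -/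
structure State where
  buffer : Finset PacketId
  cycles : PacketId → ℕ
  profit : ℕ

/-- The initial state: an empty buffer. -/
def State.init : State := ⟨∅, fun _ => 0, 0⟩

/-- The transmission step: the fully processed packets leave the queue, yielding their profits. -/
def transmit (σ : Traffic) (s : State) : State :=
  let finished := s.buffer.filter fun p => (packetAt σ p).work ≤ s.cycles p
  { buffer := s.buffer \ finished
    cycles := s.cycles
    profit := s.profit + ∑ p ∈ finished, (packetAt σ p).profit }

/-- The buffer content after the arrival step of cycle `t`, where `s` is the state after the
transmission step and `b` is the size of the buffer. A request for packets that are not present is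
void, and a request that exceeds the buffer size leaves the buffer empty. -/
def kept (b : ℕ) (σ : Traffic) (t : ℕ) (s : State) (a : Action) : Finset PacketId :=
  let present := a.retain ∩ (s.buffer ∪ arrivingIds σ t)
  if present.card ≤ b then present else ∅

/-- The packet processed in the processing step of cycle `t`, where `s` is the state after the
transmission step. Only a packet in the buffer can be processed. -/
def processed (b : ℕ) (σ : Traffic) (t : ℕ) (s : State) (a : Action) : Option PacketId :=
  a.process.filter fun p => decide (p ∈ kept b σ t s a)

/-- One cycle: transmission step, arrival step and processing step. -/
def step (b : ℕ) (σ : Traffic) (t : ℕ) (s : State) (a : Action) : State :=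
  let s' := transmit σ s
  { buffer := kept b σ t s' a
    cycles := match processed b σ t s' a with
      | some p => Function.update s'.cycles p (s'.cycles p + 1)
      | none => s'.cycles
    profit := s'.profit }

/-! ### Offline (clairvoyant) algorithms -/

/-- The state after `t` cycles if the decision in cycle `i` is `plan i`, with buffer size `b`. -/
def planRun (b : ℕ) (σ : Traffic) (plan : ℕ → Action) : ℕ → State
  | 0 => State.init
  | t + 1 => step b σ t (planRun b σ plan t) (plan t)

/-- The throughput of an optimal offline algorithm with buffer size `b` on the input `σ`: the
largest overall profit from transmitted packets over all sequences of decisions. -/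
noncomputable def optThroughput (b : ℕ) (σ : Traffic) : ℝ≥0∞ :=
  ⨆ (plan : ℕ → Action) (t : ℕ), ((planRun b σ plan t).profit : ℝ≥0∞)

/-! ### Online algorithms -/

/-- What an online algorithm has learned from a past cycle: the labels of the packets that arrived,
and the characteristics (work, profit) of the packet that it processed, if any. In particular the
characteristics of a `U`-packet are revealed when it is processed for the first time, and not
earlier. -/
structure Record where
  arrived : List (Option (ℕ × ℕ))
  revealed : Option (ℕ × ℕ)

/-- A deterministic online algorithm: it decides from the records of the past cycles and the labels
of the packets arriving in the current cycle. -/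
abbrev OnlineAlgorithm := List Record → List (Option (ℕ × ℕ)) → Action

/-- The state of the queue after `t` cycles under the online algorithm `A` with buffer size `b`,
together with the records of these cycles. -/
def onlineRun (b : ℕ) (σ : Traffic) (A : OnlineAlgorithm) : ℕ → State × List Record
  | 0 => (State.init, [])
  | t + 1 =>
    let s := (onlineRun b σ A t).1
    let past := (onlineRun b σ A t).2
    let labels := (arrivals σ t).map Packet.label
    let a := A past labels
    let seen := (processed b σ t (transmit σ s) a).map fun p =>
      ((packetAt σ p).work, (packetAt σ p).profit)
    (step b σ t s a, past ++ [⟨labels, seen⟩])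

/-- The throughput of a deterministic online algorithm with buffer size `b` on the input `σ`: the
overall profit from all packets that are ever transmitted. -/
noncomputable def onlineThroughput (b : ℕ) (σ : Traffic) (A : OnlineAlgorithm) : ℝ≥0∞ :=
  ⨆ t : ℕ, ((onlineRun b σ A t).1.profit : ℝ≥0∞)

/-- A randomized online algorithm with source of randomness `Ω`: a random deterministic online
algorithm, each of whose decisions is a (discrete) random variable. -/
structure RandomizedAlgorithm (Ω : Type*) [MeasurableSpace Ω] where
  alg : Ω → OnlineAlgorithm
  measurableSet_decision : ∀ (past : List Record) (labels : List (Option (ℕ × ℕ))) (a : Action),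
    MeasurableSet {ω | alg ω past labels = a}

variable {Ω : Type*} [MeasurableSpace Ω]

/-- The expected throughput of a randomized online algorithm with buffer size `B` on `σ`. -/
noncomputable def RandomizedAlgorithm.expectedThroughput (A : RandomizedAlgorithm Ω)
    (P : Measure Ω) (B : ℕ) (σ : Traffic) : ℝ≥0∞ :=
  ∫⁻ ω, onlineThroughput B σ (A.alg ω) ∂P

/-- `A`, with buffer size `B`, is `c`-competitive against an optimal offline algorithm with buffer
size `b`, on traffic with works in `{W₀, …, W}`, profits in `{1, …, V}` and at most `M` `U`-packets
per cycle. -/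
def RandomizedAlgorithm.IsCompetitive (A : RandomizedAlgorithm Ω) (P : Measure Ω)
    (W₀ W V M B b : ℕ) (c : ℝ≥0∞) : Prop :=
  ∀ σ : Traffic, Admissible W₀ W V M σ → optThroughput b σ ≤ c * A.expectedThroughput P B σ

/-- The competitive ratio: the infimum of all `c` for which `A` is `c`-competitive (it is `∞` if
there is no such finite `c`). -/
noncomputable def RandomizedAlgorithm.competitiveRatio (A : RandomizedAlgorithm Ω) (P : Measure Ω)
    (W₀ W V M B b : ℕ) : ℝ≥0∞ :=
  sInf {c : ℝ≥0∞ | A.IsCompetitive P W₀ W V M B b c}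

end Buffering

/-! The argument is of Yao type. In each of `N` cycles, `M` unknown packets arrive. Each is
independently good (work `W₀`, profit `V`) with probability `p = 1 / D`, where `D = V (W - 1) + 1 -
W₀`, and otherwise bad (work `W`, profit `1`).

Online side: `D` is chosen so that looking into an unknown packet is a fair bet. The potential is `W
- 1` times the profit plus a value for each started packet. It grows by `1` whenever a started
packet is processed again. On a first processing it grows by `D` if the packet is good and by `0`
otherwise, hence by `p * D = 1` on average, since the algorithm cannot correlate its choice with the
type (`firstProcessed_insert_iff`, `subsetMean_fair_bet`). So the mean profit after `N` cycles is at
most `N / (W - 1)` (`subsetMean_profit_le`), and whatever is still buffered adds at most `B * V`.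

Offline side: split time into periods of `2 * W₀` cycles. If a good packet arrives in the first
half, which has probability `1 - (1 - p) ^ (M * W₀)`, one buffer slot suffices to complete it within
the period and earn `V` (`le_optThroughput`).

With `N = 2 * W₀ * n`, averaging the competitiveness inequality over the traffic and letting `n`
grow removes `B * V` and leaves the bound. -/

namespace Buffering

/-! ### General facts on the dynamics -/

/-- At the beginning of cycle `t`, only packets that arrived before can be in the buffer or can have
been processed. -/
def State.Causal (t : ℕ) (s : State) : Prop :=
  (∀ p ∈ s.buffer, p.1 < t) ∧ ∀ p : PacketId, t ≤ p.1 → s.cycles p = 0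

theorem kept_subset (b : ℕ) (σ : Traffic) (t : ℕ) (s : State) (a : Action) :
    kept b σ t s a ⊆ s.buffer ∪ arrivingIds σ t := by
  unfold kept
  dsimp only
  split_ifs
  · exact Finset.inter_subset_right
  · exact Finset.empty_subset _

theorem card_kept_le (b : ℕ) (σ : Traffic) (t : ℕ) (s : State) (a : Action) :
    (kept b σ t s a).card ≤ b := by
  unfold kept
  dsimp only
  split_ifs with h
  · exact h
  · simp

theorem fst_of_mem_arrivingIds {σ : Traffic} {t : ℕ} {p : PacketId} (h : p ∈ arrivingIds σ t) :
    p.1 = t := by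
  unfold arrivingIds at h
  obtain ⟨i, -, rfl⟩ := Finset.mem_image.1 h
  rfl

theorem mem_kept_of_processed {b : ℕ} {σ : Traffic} {t : ℕ} {s : State} {a : Action} {p : PacketId}
    (h : processed b σ t s a = some p) : p ∈ kept b σ t s a := by
  unfold processed at h
  rw [Option.filter_eq_some_iff] at h
  simpa using h.2

theorem transmit_buffer_subset (σ : Traffic) (s : State) : (transmit σ s).buffer ⊆ s.buffer :=
  Finset.sdiff_subset

theorem step_cycles_of_some {b : ℕ} {σ : Traffic} {t : ℕ} {s : State} {a : Action} {p : PacketId}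
    (h : processed b σ t (transmit σ s) a = some p) :
    (step b σ t s a).cycles = Function.update s.cycles p (s.cycles p + 1) := by
  simp only [step, h]
  rfl

theorem step_cycles_of_none {b : ℕ} {σ : Traffic} {t : ℕ} {s : State} {a : Action}
    (h : processed b σ t (transmit σ s) a = none) :
    (step b σ t s a).cycles = s.cycles := by
  simp only [step, h]
  rfl

theorem cycles_le_step (b : ℕ) (σ : Traffic) (t : ℕ) (s : State) (a : Action) (p : PacketId) :
    s.cycles p ≤ (step b σ t s a).cycles p := by
  cases h : processed b σ t (transmit σ s) a with
  | none => rw [step_cycles_of_none h]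
  | some q =>
    rw [step_cycles_of_some h, Function.update_apply]
    split_ifs with hp
    · subst hp; omega
    · exact le_rfl

theorem State.Causal.init : State.Causal 0 State.init :=
  ⟨fun p hp => by simp [State.init] at hp, fun _ _ => rfl⟩

theorem State.Causal.step {t : ℕ} {s : State} (hs : s.Causal t) (b : ℕ) (σ : Traffic) (a : Action) :
    (step b σ t s a).Causal (t + 1) := by
  have hk : ∀ p ∈ kept b σ t (transmit σ s) a, p.1 < t + 1 := by
    intro p hp
    rcases Finset.mem_union.1 (kept_subset _ _ _ _ _ hp) with h | h
    · exact (hs.1 p (transmit_buffer_subset σ s h)).trans (Nat.lt_succ_self t)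
    · rw [fst_of_mem_arrivingIds h]; exact Nat.lt_succ_self t
  refine ⟨hk, fun p hp => ?_⟩
  cases h : processed b σ t (transmit σ s) a with
  | none => rw [step_cycles_of_none h]; exact hs.2 p (by omega)
  | some q =>
    have hq := hk q (mem_kept_of_processed h)
    rw [step_cycles_of_some h, Function.update_of_ne (by rintro rfl; omega)]
    exact hs.2 p (by omega)

theorem causal_planRun (b : ℕ) (σ : Traffic) (plan : ℕ → Action) (t : ℕ) :
    (planRun b σ plan t).Causal t := by
  induction t with
  | zero => exact State.Causal.init
  | succ t ih => exact ih.step b σ _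

theorem causal_onlineRun (b : ℕ) (σ : Traffic) (A : OnlineAlgorithm) (t : ℕ) :
    (onlineRun b σ A t).1.Causal t := by
  induction t with
  | zero => exact State.Causal.init
  | succ t ih => exact ih.step b σ _

theorem card_buffer_onlineRun_le (b : ℕ) (σ : Traffic) (A : OnlineAlgorithm) (t : ℕ) :
    (onlineRun b σ A t).1.buffer.card ≤ b := by
  cases t with
  | zero => simp [onlineRun, State.init]
  | succ t => exact card_kept_le _ _ _ _ _

theorem profit_le_step (b : ℕ) (σ : Traffic) (t : ℕ) (s : State) (a : Action) :
    s.profit ≤ (step b σ t s a).profit :=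
  Nat.le_add_right _ _

theorem monotone_profit_planRun (b : ℕ) (σ : Traffic) (plan : ℕ → Action) :
    Monotone fun t => (planRun b σ plan t).profit :=
  monotone_nat_of_le_succ fun _ => profit_le_step _ _ _ _ _

theorem monotone_profit_onlineRun (b : ℕ) (σ : Traffic) (A : OnlineAlgorithm) :
    Monotone fun t => (onlineRun b σ A t).1.profit :=
  monotone_nat_of_le_succ fun _ => profit_le_step _ _ _ _ _

/-! ### Processing a single packet without interruption -/

theorem kept_singleton {b : ℕ} (hb : 1 ≤ b) {σ : Traffic} {t : ℕ} {s : State} {q : PacketId}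
    (hq : q ∈ s.buffer ∪ arrivingIds σ t) (r : Option PacketId) :
    kept b σ t s ⟨{q}, r⟩ = {q} := by
  unfold kept
  dsimp only
  rw [Finset.singleton_inter_of_mem hq, if_pos (by simpa using hb)]

theorem step_singleton {b : ℕ} (hb : 1 ≤ b) {σ : Traffic} {t : ℕ} {s : State} {q : PacketId}
    (hq : q ∈ (transmit σ s).buffer ∪ arrivingIds σ t) :
    (step b σ t s ⟨{q}, some q⟩).buffer = {q} ∧
      (step b σ t s ⟨{q}, some q⟩).cycles q = s.cycles q + 1 := by
  have hk := kept_singleton hb hq (some q)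
  refine ⟨hk, ?_⟩
  have hp : processed b σ t (transmit σ s) ⟨{q}, some q⟩ = some q := by
    unfold processed
    rw [hk]
    simp [Option.filter]
  rw [step_cycles_of_some hp, Function.update_self]

/-- A plan that sticks to the packet `q` from its arrival on transmits it. -/
theorem profit_add_le_planRun {b : ℕ} (hb : 1 ≤ b) {σ : Traffic} {plan : ℕ → Action} {q : PacketId}
    (hq : q ∈ arrivingIds σ q.1) {w : ℕ} (hw : (packetAt σ q).work = w) (hw1 : 1 ≤ w)
    (hplan : ∀ τ, q.1 ≤ τ → τ < q.1 + w → plan τ = ⟨{q}, some q⟩) :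
    (planRun b σ plan q.1).profit + (packetAt σ q).profit
      ≤ (planRun b σ plan (q.1 + w + 1)).profit := by
  have main : ∀ j, 1 ≤ j → j ≤ w → (planRun b σ plan (q.1 + j)).buffer = {q} ∧
      (planRun b σ plan (q.1 + j)).cycles q = j := by
    intro j hj
    induction j, hj using Nat.le_induction with
    | base =>
      intro _
      have h := step_singleton hb (s := planRun b σ plan q.1) (Finset.mem_union_right _ hq)
      rw [(causal_planRun b σ plan q.1).2 q le_rfl] at h
      have e : planRun b σ plan (q.1 + 1)
          = step b σ q.1 (planRun b σ plan q.1) ⟨{q}, some q⟩ := by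
        rw [← hplan q.1 le_rfl (by omega)]; rfl
      rw [e]
      exact h
    | succ j hj ih =>
      intro hjw
      obtain ⟨h1, h2⟩ := ih (by omega)
      have hmem : q ∈ (transmit σ (planRun b σ plan (q.1 + j))).buffer := by
        simp only [transmit, h1, Finset.mem_sdiff, Finset.mem_singleton, Finset.mem_filter, h2, hw,
          true_and]
        omega
      have h := step_singleton hb (s := planRun b σ plan (q.1 + j)) (t := q.1 + j)
        (Finset.mem_union_left _ hmem)
      rw [h2] at h
      have e : planRun b σ plan (q.1 + (j + 1))
          = step b σ (q.1 + j) (planRun b σ plan (q.1 + j)) ⟨{q}, some q⟩ := by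
        rw [← hplan (q.1 + j) (by omega) (by omega)]; rfl
      rw [e]
      exact h
  obtain ⟨h1, h2⟩ := main w hw1 le_rfl
  -- The packet is finished after `w` cycles but leaves only in the transmission step of the next
  -- one, hence the `+ 1`.
  have e : (planRun b σ plan (q.1 + w + 1)).profit
      = (planRun b σ plan (q.1 + w)).profit + (packetAt σ q).profit := by
    have hf : ({q} : Finset PacketId).filter (fun p => (packetAt σ p).work
        ≤ (planRun b σ plan (q.1 + w)).cycles p) = {q} := by
      rw [Finset.filter_singleton, if_pos (by rw [hw, h2])]
    simp only [planRun, step, transmit, h1, hf, Finset.sum_singleton]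
  rw [e]
  exact Nat.add_le_add_right (monotone_profit_planRun b σ plan (by omega)) _

/-! ### Two-valued traffic of unknown packets -/

/-- In each of the cycles `0, …, N - 1` there arrive `M` unknown packets. Those in `x` have work
`W₀` and profit `V`, the others have work `W` and profit `1`. -/
def twoValued (W₀ W V M N : ℕ) (x : Finset PacketId) : Traffic :=
  (List.range N).map fun t => (List.range M).map fun i =>
    if (t, i) ∈ x then ⟨W₀, V, false⟩ else ⟨W, 1, false⟩

section TwoValued

variable {W₀ W V M N : ℕ} {x y : Finset PacketId}

theorem arrivals_twoValued (t : ℕ) : arrivals (twoValued W₀ W V M N x) t =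
    if t < N then (List.range M).map fun i =>
      if (t, i) ∈ x then ⟨W₀, V, false⟩ else ⟨W, 1, false⟩ else [] := by
  unfold arrivals twoValued
  split_ifs with h
  · simp [List.getD_eq_getElem?_getD, h]
  · simp [List.getD_eq_getElem?_getD, not_lt.1 h]

theorem arrivingIds_twoValued (t : ℕ) : arrivingIds (twoValued W₀ W V M N x) t =
    if t < N then (Finset.range M).image fun i => (t, i) else ∅ := by
  unfold arrivingIds
  rw [arrivals_twoValued]
  split_ifs <;> simp

theorem arrivingIds_twoValued_subset (t : ℕ) :
    arrivingIds (twoValued W₀ W V M N x) t ⊆ Finset.range N ×ˢ Finset.range M := by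
  rw [arrivingIds_twoValued]
  split_ifs with h
  · intro p hp
    obtain ⟨i, hi, rfl⟩ := Finset.mem_image.1 hp
    exact Finset.mem_product.2 ⟨Finset.mem_range.2 h, hi⟩
  · exact Finset.empty_subset _

theorem packetAt_twoValued {q : PacketId} (hq : q ∈ Finset.range N ×ˢ Finset.range M) :
    packetAt (twoValued W₀ W V M N x) q =
      if q ∈ x then ⟨W₀, V, false⟩ else ⟨W, 1, false⟩ := by
  obtain ⟨t, i⟩ := q
  obtain ⟨h1, h2⟩ := Finset.mem_product.1 hq
  rw [Finset.mem_range] at h1 h2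
  unfold packetAt
  simp only at h1 h2 ⊢
  rw [arrivals_twoValued, if_pos h1]
  simp [List.getD_eq_getElem?_getD, h2]

theorem packetAt_twoValued_congr {p : PacketId} (h : p ∈ x ↔ p ∈ y) :
    packetAt (twoValued W₀ W V M N x) p = packetAt (twoValued W₀ W V M N y) p := by
  obtain ⟨t, i⟩ := p
  unfold packetAt
  simp only
  rw [arrivals_twoValued, arrivals_twoValued]
  split_ifs
  · by_cases hi : i < M
    · simp [List.getD_eq_getElem?_getD, hi, h]
    · simp [List.getD_eq_getElem?_getD, not_lt.1 hi]
  · rfl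

/-- Every packet is unknown, so arrivals carry no information about `x`; only processing does. -/
theorem labels_twoValued (t : ℕ) :
    (arrivals (twoValued W₀ W V M N x) t).map Packet.label =
      (arrivals (twoValued W₀ W V M N y) t).map Packet.label := by
  rw [arrivals_twoValued, arrivals_twoValued]
  split_ifs
  · rw [List.map_map, List.map_map]
    refine List.map_congr_left fun i _ => ?_
    simp only [Function.comp, Packet.label]
    split_ifs <;> simp_all
  · rfl

theorem admissible_twoValued (hW₀W : W₀ ≤ W) (hV : 1 ≤ V) :
    Admissible W₀ W V M (twoValued W₀ W V M N x) := by
  intro cycle hc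
  obtain ⟨t, -, rfl⟩ := List.mem_map.1 hc
  refine ⟨fun p hp => ?_, ?_⟩
  · obtain ⟨i, -, rfl⟩ := List.mem_map.1 hp
    split_ifs <;> simp [hW₀W, hV]
  · exact List.countP_le_length.trans (by simp)

theorem buffer_onlineRun_subset (B : ℕ) (A : OnlineAlgorithm) (t : ℕ) :
    (onlineRun B (twoValued W₀ W V M N x) A t).1.buffer ⊆ Finset.range N ×ˢ Finset.range M := by
  induction t with
  | zero => simp [onlineRun, State.init]
  | succ t ih =>
    refine (kept_subset _ _ _ _ _).trans (Finset.union_subset ?_ (arrivingIds_twoValued_subset t))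
    exact (transmit_buffer_subset _ _).trans ih

/-! ### The run does not depend on packets that have not been processed yet -/

/-- Both possible works of `q` are positive, so an unprocessed `q` is not transmitted under either
type. -/
theorem transmit_twoValued_congr (hW₀ : 1 ≤ W₀) (hW : 1 ≤ W) {q : PacketId}
    (hq : q ∈ Finset.range N ×ˢ Finset.range M) (hxy : ∀ p, p ≠ q → (p ∈ x ↔ p ∈ y)) {s : State}
    (hs : s.cycles q = 0) :
    transmit (twoValued W₀ W V M N x) s = transmit (twoValued W₀ W V M N y) s := by
  have hx : ∀ z, ¬ (packetAt (twoValued W₀ W V M N z) q).work ≤ s.cycles q := by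
    intro z
    rw [packetAt_twoValued hq, hs]
    split_ifs <;> simp <;> omega
  have hf : (s.buffer.filter fun p => (packetAt (twoValued W₀ W V M N x) p).work ≤ s.cycles p)
      = s.buffer.filter fun p => (packetAt (twoValued W₀ W V M N y) p).work ≤ s.cycles p := by
    refine Finset.filter_congr fun p _ => ?_
    by_cases hp : p = q
    · subst hp
      exact iff_of_false (hx x) (hx y)
    · rw [packetAt_twoValued_congr (hxy p hp)]
  unfold transmit
  dsimp only
  rw [hf]
  congr 2
  refine Finset.sum_congr rfl fun p hp => ?_
  have hpq : p ≠ q := by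
    rintro rfl
    exact hx y (Finset.mem_filter.1 hp).2
  rw [packetAt_twoValued_congr (hxy p hpq)]

theorem kept_twoValued (b t : ℕ) (s : State) (a : Action) :
    kept b (twoValued W₀ W V M N x) t s a = kept b (twoValued W₀ W V M N y) t s a := by
  unfold kept
  rw [arrivingIds_twoValued, arrivingIds_twoValued]

theorem processed_twoValued (b t : ℕ) (s : State) (a : Action) :
    processed b (twoValued W₀ W V M N x) t s a = processed b (twoValued W₀ W V M N y) t s a := by
  unfold processed
  rw [kept_twoValued (y := y)]

/-- Until `q` is processed, its type affects neither the state nor the records, so the algorithm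
takes the same decisions for both types. -/
theorem onlineRun_twoValued_congr (hW₀ : 1 ≤ W₀) (hW : 1 ≤ W) {q : PacketId}
    (hq : q ∈ Finset.range N ×ˢ Finset.range M) (hxy : ∀ p, p ≠ q → (p ∈ x ↔ p ∈ y))
    (B : ℕ) (A : OnlineAlgorithm) (t : ℕ)
    (h : (onlineRun B (twoValued W₀ W V M N x) A t).1.cycles q = 0) :
    onlineRun B (twoValued W₀ W V M N x) A t = onlineRun B (twoValued W₀ W V M N y) A t := by
  induction t with
  | zero => rfl
  | succ t ih =>
    have h0 : (onlineRun B (twoValued W₀ W V M N x) A t).1.cycles q = 0 :=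
      Nat.le_zero.1 (h ▸ cycles_le_step _ _ _ _ _ q)
    have ih := ih h0
    have htr := transmit_twoValued_congr (V := V) hW₀ hW hq hxy h0
    -- Processing `q` in this cycle would make its counter positive. Hence the revealed
    -- characteristics belong to another packet, and the new records agree.
    have hp : processed B (twoValued W₀ W V M N x) t
        (transmit (twoValued W₀ W V M N x) (onlineRun B (twoValued W₀ W V M N x) A t).1)
        (A (onlineRun B (twoValued W₀ W V M N x) A t).2
          ((arrivals (twoValued W₀ W V M N x) t).map Packet.label)) ≠ some q := by
      intro hp
      have := congrFun (step_cycles_of_some hp) q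
      rw [Function.update_self] at this
      have h' := h
      simp only [onlineRun] at h'
      omega
    simp only [onlineRun, step]
    rw [htr, labels_twoValued (y := y), kept_twoValued (y := y), processed_twoValued (y := y)]
    rw [htr, labels_twoValued (y := y), processed_twoValued (y := y)] at hp
    rw [← ih]
    congr 4
    refine Option.map_congr fun p hp' => ?_
    have hpq : p ≠ q := by
      rintro rfl
      exact hp hp'
    rw [packetAt_twoValued_congr (hxy p hpq)]

/-- The packet that the online algorithm processes in cycle `t`. -/
def onlineProcessed (b : ℕ) (σ : Traffic) (A : OnlineAlgorithm) (t : ℕ) : Option PacketId :=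
  processed b σ t (transmit σ (onlineRun b σ A t).1)
    (A (onlineRun b σ A t).2 ((arrivals σ t).map Packet.label))

/-- In cycle `t` the online algorithm processes the packet `q` for the first time. -/
def FirstProcessed (b : ℕ) (σ : Traffic) (A : OnlineAlgorithm) (t : ℕ) (q : PacketId) : Prop :=
  onlineProcessed b σ A t = some q ∧ (onlineRun b σ A t).1.cycles q = 0

theorem FirstProcessed.congr (hW₀ : 1 ≤ W₀) (hW : 1 ≤ W) {q : PacketId}
    (hq : q ∈ Finset.range N ×ˢ Finset.range M) (hxy : ∀ p, p ≠ q → (p ∈ x ↔ p ∈ y))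
    {B : ℕ} {A : OnlineAlgorithm} {t : ℕ}
    (h : FirstProcessed B (twoValued W₀ W V M N x) A t q) :
    FirstProcessed B (twoValued W₀ W V M N y) A t q := by
  have e := onlineRun_twoValued_congr hW₀ hW hq hxy B A t h.2
  refine ⟨?_, e ▸ h.2⟩
  have h1 := h.1
  unfold onlineProcessed at h1 ⊢
  rw [transmit_twoValued_congr hW₀ hW hq hxy h.2, labels_twoValued (y := y),
    processed_twoValued (y := y), e] at h1
  exact h1

/-- The decision to look into `q` is independent of the type of `q`: this is the hypothesis of
`subsetMean_fair_bet`. -/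
theorem firstProcessed_insert_iff (hW₀ : 1 ≤ W₀) (hW : 1 ≤ W) {q : PacketId}
    (hq : q ∈ Finset.range N ×ˢ Finset.range M) {B : ℕ} {A : OnlineAlgorithm} {t : ℕ} :
    FirstProcessed B (twoValued W₀ W V M N (insert q x)) A t q ↔
      FirstProcessed B (twoValued W₀ W V M N x) A t q :=
  ⟨fun h => h.congr hW₀ hW hq fun p hp => by simp [hp],
    fun h => h.congr hW₀ hW hq fun p hp => by simp [hp]⟩

/-! ### The potential of an online run -/

/-- The contribution of a buffered packet with `c` processing cycles to the potential. -/
def packetPotential (W₀ W V : ℕ) (x : Finset PacketId) (q : PacketId) (c : ℕ) : ℝ :=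
  if c = 0 then 0 else if q ∈ x then ((W : ℝ) - 1) * V - W₀ + c else c - 1

/-- Ensures that dropping packets never raises the potential, and that the potential dominates the
scaled profit. -/
theorem packetPotential_nonneg (hD : W₀ ≤ V * (W - 1)) (hW : 1 ≤ W) (q : PacketId) (c : ℕ) :
    0 ≤ packetPotential W₀ W V x q c := by
  have hD' : (W₀ : ℝ) ≤ V * ((W : ℝ) - 1) := by
    rw [← Nat.cast_one, ← Nat.cast_sub hW]; exact_mod_cast hD
  unfold packetPotential
  have hc : c ≠ 0 → (1 : ℝ) ≤ c := fun h => by exact_mod_cast Nat.one_le_iff_ne_zero.2 h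
  split_ifs with h1 h2
  · exact le_rfl
  · have := hc h1; linarith
  · have := hc h1; linarith

/-- The offsets in `packetPotential` are calibrated so that, exactly at completion (`c = W₀` or `c =
W`), the contribution equals the scaled profit `(W - 1) * V` or `W - 1`. -/
theorem profit_le_packetPotential (hW₀ : 1 ≤ W₀) (hW : 1 ≤ W) {q : PacketId}
    (hq : q ∈ Finset.range N ×ˢ Finset.range M) {c : ℕ}
    (hc : (packetAt (twoValued W₀ W V M N x) q).work ≤ c) :
    ((W : ℝ) - 1) * (packetAt (twoValued W₀ W V M N x) q).profit
      ≤ packetPotential W₀ W V x q c := by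
  rw [packetAt_twoValued hq] at hc ⊢
  unfold packetPotential
  by_cases hqx : q ∈ x
  · simp only [hqx, if_true] at hc ⊢
    rw [if_neg (by omega)]
    have : (W₀ : ℝ) ≤ c := by exact_mod_cast hc
    linarith
  · simp only [hqx, if_false] at hc ⊢
    rw [if_neg (by omega)]
    have : (W : ℝ) ≤ c := by exact_mod_cast hc
    push_cast
    linarith

/-- The potential of a state: the collected profit, scaled by `W - 1`, and the contributions of the
buffered packets. -/
def potential (W₀ W V : ℕ) (x : Finset PacketId) (s : State) : ℝ :=
  ((W : ℝ) - 1) * s.profit + ∑ q ∈ s.buffer, packetPotential W₀ W V x q (s.cycles q)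

/-- Transmission exchanges the contribution of each finished packet for its scaled profit, which is
no larger. -/
theorem potential_transmit_le (hW₀ : 1 ≤ W₀) (hW : 1 ≤ W) {s : State}
    (hs : s.buffer ⊆ Finset.range N ×ˢ Finset.range M) :
    potential W₀ W V x (transmit (twoValued W₀ W V M N x) s) ≤ potential W₀ W V x s := by
  set σ := twoValued W₀ W V M N x
  set F := s.buffer.filter fun p => (packetAt σ p).work ≤ s.cycles p with hF
  have hsplit := Finset.sum_sdiff (f := fun q => packetPotential W₀ W V x q (s.cycles q))
    (Finset.filter_subset (fun p => (packetAt σ p).work ≤ s.cycles p) s.buffer)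
  have hle : ∑ q ∈ F, ((W : ℝ) - 1) * (packetAt σ q).profit
      ≤ ∑ q ∈ F, packetPotential W₀ W V x q (s.cycles q) := by
    refine Finset.sum_le_sum fun q hq => ?_
    have := Finset.mem_filter.1 hq
    exact profit_le_packetPotential hW₀ hW (hs this.1) this.2
  rw [← Finset.mul_sum] at hle
  unfold potential transmit
  simp only [← hF] at hsplit ⊢
  push_cast
  linarith

/-- Only processing can raise the potential: transmission and dropping do not, and new arrivals
contribute zero because causality leaves them unprocessed. -/
theorem potential_step_le (hD : W₀ ≤ V * (W - 1)) (hW₀ : 1 ≤ W₀) (hW : 1 ≤ W) {b t : ℕ} {s : State}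
    (hc : s.Causal t) (hs : s.buffer ⊆ Finset.range N ×ˢ Finset.range M) (a : Action) :
    potential W₀ W V x (step b (twoValued W₀ W V M N x) t s a) ≤ potential W₀ W V x s +
      match processed b (twoValued W₀ W V M N x) t (transmit (twoValued W₀ W V M N x) s) a with
      | some q => packetPotential W₀ W V x q (s.cycles q + 1)
          - packetPotential W₀ W V x q (s.cycles q)
      | none => 0 := by
  refine le_trans ?_ (add_le_add_left (potential_transmit_le (V := V) (x := x) hW₀ hW hs) _)
  set σ := twoValued W₀ W V M N x
  set s' := transmit σ s
  have hbuf : ∑ q ∈ kept b σ t s' a, packetPotential W₀ W V x q (s.cycles q)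
      ≤ ∑ q ∈ s'.buffer, packetPotential W₀ W V x q (s.cycles q) := by
    calc _ ≤ ∑ q ∈ s'.buffer ∪ arrivingIds σ t, packetPotential W₀ W V x q (s.cycles q) :=
          Finset.sum_le_sum_of_subset_of_nonneg (kept_subset _ _ _ _ _)
            fun q _ _ => packetPotential_nonneg hD hW q _
      _ = _ := by
          refine (Finset.sum_subset Finset.subset_union_left fun q hq hq' => ?_).symm
          have ha := (Finset.mem_union.1 hq).resolve_left hq'
          rw [hc.2 q (fst_of_mem_arrivingIds ha).ge]
          simp [packetPotential]
  cases h : processed b σ t s' a with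
  | none =>
    simp only [add_zero]
    unfold potential
    rw [step_cycles_of_none h]
    exact add_le_add_right hbuf _
  | some q =>
    have hq := mem_kept_of_processed h
    unfold potential
    rw [step_cycles_of_some h, add_assoc]
    refine add_le_add_right ?_ _
    refine le_trans (le_of_eq ?_) (add_le_add_left hbuf _)
    change ∑ r ∈ kept b σ t s' a, _ = _
    rw [← Finset.add_sum_erase _ _ hq, ← Finset.add_sum_erase _ _ hq, Function.update_self]
    rw [Finset.sum_congr rfl fun r hr => by
      rw [Function.update_of_ne (Finset.ne_of_mem_erase hr)]]
    ring

-- Each cycle is charged `1`, which covers processing a started packet or idling. A first processing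
-- deviates from this charge by `D - 1` or `-1`, written as a sum of bets, at most one of them
-- active, so that each can be averaged separately.
open Classical in
theorem potential_onlineRun_succ_le (hD : W₀ ≤ V * (W - 1)) (hW₀ : 1 ≤ W₀) (hW : 1 ≤ W) (B : ℕ)
    (A : OnlineAlgorithm) (t : ℕ) :
    potential W₀ W V x (onlineRun B (twoValued W₀ W V M N x) A (t + 1)).1
      ≤ potential W₀ W V x (onlineRun B (twoValued W₀ W V M N x) A t).1 + 1 +
        ∑ q ∈ Finset.range N ×ˢ Finset.range M,
          if FirstProcessed B (twoValued W₀ W V M N x) A t q then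
            (if q ∈ x then (V : ℝ) * ((W : ℝ) - 1) + 1 - W₀ else 0) - 1 else 0 := by
  have h := potential_step_le (V := V) (x := x) hD hW₀ hW (b := B)
    (causal_onlineRun B (twoValued W₀ W V M N x) A t)
    (buffer_onlineRun_subset (W₀ := W₀) (W := W) (V := V) (x := x) B A t)
    (A (onlineRun B (twoValued W₀ W V M N x) A t).2
      ((arrivals (twoValued W₀ W V M N x) t).map Packet.label))
  refine le_trans h ?_
  rw [add_assoc]
  refine add_le_add_right ?_ _
  change (match onlineProcessed B (twoValued W₀ W V M N x) A t with
    | some q => _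
    | none => _) ≤ _
  cases hp : onlineProcessed B (twoValued W₀ W V M N x) A t with
  | none =>
    rw [Finset.sum_eq_zero fun q _ => if_neg fun hf => by rw [hf.1] at hp; cases hp]
    norm_num
  | some q =>
    have hq : q ∈ Finset.range N ×ˢ Finset.range M := by
      have := kept_subset _ _ _ _ _ (mem_kept_of_processed hp)
      rcases Finset.mem_union.1 this with h | h
      · exact buffer_onlineRun_subset B A t (transmit_buffer_subset _ _ h)
      · exact arrivingIds_twoValued_subset t h
    rw [Finset.sum_eq_single_of_mem q hq fun r _ hr => if_neg fun hf => hr ?_]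
    swap
    · rw [hf.1] at hp
      exact Option.some.inj hp
    by_cases hc : (onlineRun B (twoValued W₀ W V M N x) A t).1.cycles q = 0
    · rw [if_pos ⟨hp, hc⟩]
      simp only [hc, packetPotential]
      by_cases hqx : q ∈ x <;> simp [hqx]; linarith
    · rw [if_neg fun hf => hc hf.2]
      simp only [packetPotential, hc]
      by_cases hqx : q ∈ x <;> simp [hqx]

end TwoValued

/-! ### Averages over random subsets -/

/-- The expectation of `f x` if `x` contains each element of `S` independently with
probability `p`. -/
def subsetMean {α : Type*} (S : Finset α) (p : ℝ) (f : Finset α → ℝ) : ℝ :=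
  ∑ x ∈ S.powerset, p ^ x.card * (1 - p) ^ (S.card - x.card) * f x

section SubsetMean

variable {α : Type*} {S : Finset α} {p : ℝ}

theorem subsetMean_const (S : Finset α) (p c : ℝ) : subsetMean S p (fun _ => c) = c := by
  unfold subsetMean
  rw [← Finset.sum_mul, Finset.sum_pow_mul_eq_add_pow]
  simp

theorem subsetMean_add (f g : Finset α → ℝ) :
    subsetMean S p (fun x => f x + g x) = subsetMean S p f + subsetMean S p g := by
  simp only [subsetMean, mul_add, Finset.sum_add_distrib]

theorem subsetMean_const_mul (c : ℝ) (f : Finset α → ℝ) :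
    subsetMean S p (fun x => c * f x) = c * subsetMean S p f := by
  simp only [subsetMean, Finset.mul_sum]
  exact Finset.sum_congr rfl fun x _ => by ring

theorem subsetMean_sum {ι : Type*} (I : Finset ι) (f : ι → Finset α → ℝ) :
    subsetMean S p (fun x => ∑ i ∈ I, f i x) = ∑ i ∈ I, subsetMean S p (f i) := by
  simp only [subsetMean, Finset.mul_sum]
  exact Finset.sum_comm

theorem weight_nonneg (h0 : 0 ≤ p) (h1 : p ≤ 1) (m n : ℕ) : 0 ≤ p ^ m * (1 - p) ^ n :=
  mul_nonneg (pow_nonneg h0 _) (pow_nonneg (sub_nonneg.2 h1) _)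

theorem subsetMean_mono (h0 : 0 ≤ p) (h1 : p ≤ 1) {f g : Finset α → ℝ} (h : ∀ x, f x ≤ g x) :
    subsetMean S p f ≤ subsetMean S p g :=
  Finset.sum_le_sum fun x _ => mul_le_mul_of_nonneg_left (h x) (weight_nonneg h0 h1 _ _)

/-- A fair bet on whether `q ∈ x`, placed without knowledge of this, has expectation zero. -/
theorem subsetMean_fair_bet [DecidableEq α] {q : α} (hq : q ∈ S) {D : ℝ} (hD : p * D = 1)
    (F : Finset α → Prop) [DecidablePred F] (hF : ∀ x, F (insert q x) ↔ F x) :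
    subsetMean S p (fun x => if F x then (if q ∈ x then D else 0) - 1 else 0) = 0 := by
  unfold subsetMean
  conv_lhs => rw [← Finset.insert_erase hq]
  rw [Finset.sum_powerset_insert (Finset.notMem_erase q S), ← Finset.sum_add_distrib]
  refine Finset.sum_eq_zero fun x hx => ?_
  have hqx : q ∉ x := fun h => Finset.notMem_erase q S (Finset.mem_powerset.1 hx h)
  have hcard := Finset.card_le_card (Finset.mem_powerset.1 hx)
  rw [Finset.card_insert_of_notMem hqx, Finset.card_insert_of_notMem (Finset.notMem_erase q S)]
  dsimp only
  by_cases h : F x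
  · rw [if_pos h, if_pos ((hF x).2 h), if_neg hqx, if_pos (Finset.mem_insert_self q x),
      Nat.add_sub_add_right, Nat.sub_add_comm hcard, pow_succ, pow_succ]
    -- Pairing `x` with `insert q x` leaves the common weight times `p * (D - 1) - (1 - p) = p * D -
    -- 1`.
    linear_combination (p ^ x.card * (1 - p) ^ ((S.erase q).card - x.card)) * hD
  · rw [if_neg h, if_neg (mt (hF x).1 h)]
    ring

theorem subsetMean_disjoint [DecidableEq α] {T : Finset α} (hT : T ⊆ S) :
    subsetMean S p (fun x => if Disjoint x T then 1 else 0) = (1 - p) ^ T.card := by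
  unfold subsetMean
  simp only [mul_ite, mul_one, mul_zero]
  rw [← Finset.sum_filter]
  have hset : S.powerset.filter (fun x => Disjoint x T) = (S \ T).powerset := by
    ext x
    simp [Finset.subset_sdiff]
  rw [hset]
  have hcard := Finset.card_sdiff_add_card_eq_card hT
  calc _ = ∑ x ∈ (S \ T).powerset,
        (1 - p) ^ T.card * (p ^ x.card * (1 - p) ^ ((S \ T).card - x.card)) := by
        refine Finset.sum_congr rfl fun x hx => ?_
        have := Finset.card_le_card (Finset.mem_powerset.1 hx)
        rw [show S.card - x.card = T.card + ((S \ T).card - x.card) by omega, pow_add]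
        ring
    _ = _ := by
        rw [← Finset.mul_sum, Finset.sum_pow_mul_eq_add_pow]
        simp

end SubsetMean

/-! ### The throughput of a deterministic online algorithm on random two-valued traffic -/

section Online

variable {W₀ W V M N : ℕ}

/-- All bets have mean zero, so the mean potential grows by at most `1` per cycle. -/
theorem subsetMean_profit_le (hD : W₀ ≤ V * (W - 1)) (hW₀ : 1 ≤ W₀) (hW : 1 ≤ W)
    {p : ℝ} (h0 : 0 ≤ p) (h1 : p ≤ 1) (hp : p * ((V : ℝ) * ((W : ℝ) - 1) + 1 - W₀) = 1)
    (B : ℕ) (A : OnlineAlgorithm) (t : ℕ) :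
    ((W : ℝ) - 1) * subsetMean (Finset.range N ×ˢ Finset.range M) p
      (fun x => ((onlineRun B (twoValued W₀ W V M N x) A t).1.profit : ℝ)) ≤ t := by
  classical
  have key : subsetMean (Finset.range N ×ˢ Finset.range M) p
      (fun x => potential W₀ W V x (onlineRun B (twoValued W₀ W V M N x) A t).1) ≤ t := by
    induction t with
    | zero => simp [subsetMean, potential, onlineRun, State.init]
    | succ t ih =>
      refine le_trans (subsetMean_mono h0 h1 fun x =>
        potential_onlineRun_succ_le hD hW₀ hW B A t) ?_
      rw [subsetMean_add, subsetMean_add, subsetMean_const, subsetMean_sum,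
        Finset.sum_eq_zero fun q hq => ?_]
      · push_cast
        linarith
      · exact subsetMean_fair_bet hq hp
          (fun x => FirstProcessed B (twoValued W₀ W V M N x) A t q) fun x => firstProcessed_insert_iff hW₀ hW hq
  rw [← subsetMean_const_mul]
  refine le_trans (subsetMean_mono h0 h1 fun x => ?_) key
  exact le_add_of_nonneg_right (Finset.sum_nonneg fun q _ => packetPotential_nonneg hD hW q _)

/-- Once arrivals stop, the collected profit plus the profit still in the buffer cannot increase,
and the buffer is worth at most `B * V`. -/
theorem onlineThroughput_le (hV : 1 ≤ V) (x : Finset PacketId) (B : ℕ) (A : OnlineAlgorithm) :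
    onlineThroughput B (twoValued W₀ W V M N x) A
      ≤ (((onlineRun B (twoValued W₀ W V M N x) A N).1.profit + B * V : ℕ) : ℝ≥0∞) := by
  set σ := twoValued W₀ W V M N x with hσ
  have hstep : ∀ t, N ≤ t → (onlineRun B σ A t).1.profit
      + ∑ q ∈ (onlineRun B σ A t).1.buffer, (packetAt σ q).profit
      ≤ (onlineRun B σ A N).1.profit
      + ∑ q ∈ (onlineRun B σ A N).1.buffer, (packetAt σ q).profit := by
    intro t ht
    induction t, ht using Nat.le_induction with
    | base => exact le_rfl
    | succ t ht ih =>
      refine le_trans ?_ ih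
      set s := (onlineRun B σ A t).1 with hs
      have harr : arrivingIds σ t = ∅ := by
        rw [hσ, arrivingIds_twoValued, if_neg (by omega)]
      have hsub : (onlineRun B σ A (t + 1)).1.buffer ⊆ (transmit σ s).buffer := by
        have := kept_subset B σ t (transmit σ s)
          (A (onlineRun B σ A t).2 ((arrivals σ t).map Packet.label))
        rwa [harr, Finset.union_empty] at this
      have hle := Finset.sum_le_sum_of_subset (f := fun q => (packetAt σ q).profit) hsub
      have hpr : (onlineRun B σ A (t + 1)).1.profit = (transmit σ s).profit := rfl
      have hsplit := Finset.sum_sdiff (f := fun q => (packetAt σ q).profit)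
        (Finset.filter_subset (fun p => (packetAt σ p).work ≤ s.cycles p) s.buffer)
      rw [hpr]
      simp only [transmit] at hle ⊢
      omega
  have hbuf : ∑ q ∈ (onlineRun B σ A N).1.buffer, (packetAt σ q).profit ≤ B * V := by
    refine le_trans (Finset.sum_le_card_nsmul _ _ V fun q hq => ?_) ?_
    · rw [packetAt_twoValued (buffer_onlineRun_subset B A N hq)]
      split_ifs
      · exact le_rfl
      · exact hV
    · rw [smul_eq_mul]
      exact Nat.mul_le_mul_right V (card_buffer_onlineRun_le B σ A N)
  refine iSup_le fun t => ?_
  rw [Nat.cast_le]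
  rcases le_total N t with ht | ht
  · have := hstep t ht
    omega
  · have : (onlineRun B σ A t).1.profit ≤ (onlineRun B σ A N).1.profit :=
      monotone_profit_onlineRun B σ A ht
    omega

theorem sum_onlineThroughput_le (hD : W₀ ≤ V * (W - 1)) (hW₀ : 1 ≤ W₀) (hW : 2 ≤ W) (hV : 1 ≤ V)
    {p : ℝ} (h0 : 0 ≤ p) (h1 : p ≤ 1) (hp : p * ((V : ℝ) * ((W : ℝ) - 1) + 1 - W₀) = 1)
    (B : ℕ) (A : OnlineAlgorithm) :
    ∑ x ∈ (Finset.range N ×ˢ Finset.range M).powerset,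
      ENNReal.ofReal (p ^ x.card *
        (1 - p) ^ ((Finset.range N ×ˢ Finset.range M).card - x.card)) *
        onlineThroughput B (twoValued W₀ W V M N x) A
      ≤ ENNReal.ofReal ((N : ℝ) / ((W : ℝ) - 1) + B * V) := by
  set S := Finset.range N ×ˢ Finset.range M
  have hW' : (0 : ℝ) < (W : ℝ) - 1 := by
    have : (2 : ℝ) ≤ W := by exact_mod_cast hW
    linarith
  calc _ ≤ ∑ x ∈ S.powerset, ENNReal.ofReal (p ^ x.card * (1 - p) ^ (S.card - x.card) *
        (((onlineRun B (twoValued W₀ W V M N x) A N).1.profit : ℝ) + B * V)) := by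
        refine Finset.sum_le_sum fun x _ => ?_
        rw [ENNReal.ofReal_mul (weight_nonneg h0 h1 _ _)]
        refine mul_le_mul_right ((onlineThroughput_le hV x B A).trans (le_of_eq ?_)) _
        rw [← ENNReal.ofReal_natCast]
        push_cast
        rfl
    _ = ENNReal.ofReal (subsetMean S p fun x =>
        ((onlineRun B (twoValued W₀ W V M N x) A N).1.profit : ℝ) + B * V) := by
        rw [← ENNReal.ofReal_sum_of_nonneg fun x _ =>
          mul_nonneg (weight_nonneg h0 h1 _ _) (by positivity)]
        rfl
    _ ≤ _ := by
        refine ENNReal.ofReal_le_ofReal ?_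
        rw [subsetMean_add, subsetMean_const]
        refine add_le_add_left ?_ _
        rw [le_div_iff₀' hW']
        exact subsetMean_profit_le hD hW₀ (by omega) h0 h1 hp B A N

end Online

/-! ### The throughput of an offline algorithm on random two-valued traffic -/

section Offline

variable {W₀ W V M : ℕ}

/-- The packets arriving in the first half of the `k`-th period of `2 * W₀` cycles. -/
def halfPeriod (W₀ M k : ℕ) : Finset PacketId :=
  Finset.Ico (2 * W₀ * k) (2 * W₀ * k + W₀) ×ˢ Finset.range M

theorem halfPeriod_subset {n k : ℕ} (hk : k < n) :
    halfPeriod W₀ M k ⊆ Finset.range (2 * W₀ * n) ×ˢ Finset.range M := by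
  refine Finset.product_subset_product_left fun t ht => ?_
  have h1 := (Finset.mem_Ico.1 ht).2
  have h2 : 2 * W₀ * (k + 1) ≤ 2 * W₀ * n := Nat.mul_le_mul_left _ hk
  rw [Finset.mem_range]
  rw [Nat.mul_add] at h2
  omega

theorem le_optThroughput (hW₀ : 1 ≤ W₀) {b : ℕ} (hb : 1 ≤ b) (n : ℕ) (x : Finset PacketId) :
    ((∑ k ∈ Finset.range n, if Disjoint x (halfPeriod W₀ M k) then 0 else V : ℕ) : ℝ≥0∞)
      ≤ optThroughput b (twoValued W₀ W V M (2 * W₀ * n) x) := by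
  set σ := twoValued W₀ W V M (2 * W₀ * n) x with hσ
  classical
  -- A good packet from the first half of period `k`. The default `(0, 0)` is harmless: such a
  -- period is credited nothing, and profit never decreases.
  let choice : ℕ → PacketId := fun k =>
    if h : ∃ q, q ∈ x ∧ q ∈ halfPeriod W₀ M k then h.choose else (0, 0)
  have hchoice : ∀ k, ¬ Disjoint x (halfPeriod W₀ M k) →
      choice k ∈ x ∧ choice k ∈ halfPeriod W₀ M k := by
    intro k hk
    have h : ∃ q, q ∈ x ∧ q ∈ halfPeriod W₀ M k := Finset.not_disjoint_iff.1 hk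
    simp only [choice, dif_pos h]
    exact h.choose_spec
  let plan : ℕ → Action := fun τ => ⟨{choice (τ / (2 * W₀))}, some (choice (τ / (2 * W₀)))⟩
  have main : ∀ m ≤ n, (∑ k ∈ Finset.range m, if Disjoint x (halfPeriod W₀ M k) then 0 else V)
      ≤ (planRun b σ plan (2 * W₀ * m)).profit := by
    intro m
    induction m with
    | zero => simp
    | succ m ih =>
      intro hm
      have ih := ih (by omega)
      have e : 2 * W₀ * (m + 1) = 2 * W₀ * m + 2 * W₀ := by ring
      rw [Finset.sum_range_succ]
      split_ifs with hd
      · exact ih.trans (monotone_profit_planRun b σ plan (by omega))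
      · obtain ⟨hx, hmem⟩ := hchoice m hd
        have hS := halfPeriod_subset (n := n) (by omega) hmem
        obtain ⟨ht, hi⟩ := Finset.mem_product.1 hmem
        obtain ⟨ht1, ht2⟩ := Finset.mem_Ico.1 ht
        have hpk := packetAt_twoValued (W₀ := W₀) (W := W) (V := V) (x := x) hS
        rw [if_pos hx] at hpk
        have harr : choice m ∈ arrivingIds σ (choice m).1 := by
          rw [hσ, arrivingIds_twoValued,
            if_pos (Finset.mem_range.1 (Finset.mem_product.1 hS).1)]
          exact Finset.mem_image.2 ⟨_, hi, rfl⟩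
        have h := profit_add_le_planRun hb (plan := plan) harr (w := W₀) (by rw [hpk]) hW₀ (by
          intro τ h1 h2
          have : τ / (2 * W₀) = m := by
            rw [Nat.div_eq_iff (by omega)]
            constructor
            · rw [mul_comm]; omega
            · rw [mul_comm m]; omega
          simp only [plan, this])
        rw [hpk] at h
        -- Arrival by cycle `2 * W₀ * m + W₀ - 1` puts the transmission in cycle `2 * W₀ * (m + 1) -
        -- 1` at the latest, just inside the period.
        refine le_trans (Nat.add_le_add_right ih V) (le_trans ?_ (h.trans
          (monotone_profit_planRun b σ plan (by omega))))
        exact Nat.add_le_add_right (monotone_profit_planRun b σ plan ht1) V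
  refine le_trans ?_ (le_iSup₂ (f := fun plan t => ((planRun b σ plan t).profit : ℝ≥0∞))
    plan (2 * W₀ * n))
  exact_mod_cast main n le_rfl

theorem le_sum_optThroughput (hW₀ : 1 ≤ W₀) {b : ℕ} (hb : 1 ≤ b) {p : ℝ} (h0 : 0 ≤ p) (h1 : p ≤ 1)
    (n : ℕ) :
    ENNReal.ofReal (n * (V * (1 - (1 - p) ^ (M * W₀)))) ≤
    ∑ x ∈ (Finset.range (2 * W₀ * n) ×ˢ Finset.range M).powerset,
      ENNReal.ofReal (p ^ x.card *
        (1 - p) ^ ((Finset.range (2 * W₀ * n) ×ˢ Finset.range M).card - x.card)) *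
        optThroughput b (twoValued W₀ W V M (2 * W₀ * n) x) := by
  set S := Finset.range (2 * W₀ * n) ×ˢ Finset.range M
  have hmean : (n : ℝ) * (V * (1 - (1 - p) ^ (M * W₀))) = subsetMean S p fun x =>
      ((∑ k ∈ Finset.range n, if Disjoint x (halfPeriod W₀ M k) then 0 else V : ℕ) : ℝ) := by
    have hk : ∀ k ∈ Finset.range n, subsetMean S p
        (fun x => (V : ℝ) + (-V) * if Disjoint x (halfPeriod W₀ M k) then 1 else 0)
        = V * (1 - (1 - p) ^ (M * W₀)) := by
      intro k hk
      have hcard : (halfPeriod W₀ M k).card = M * W₀ := by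
        simp [halfPeriod, mul_comm]
      rw [subsetMean_add, subsetMean_const, subsetMean_const_mul,
        subsetMean_disjoint (halfPeriod_subset (Finset.mem_range.1 hk)), hcard]
      ring
    have hfun : (fun x : Finset PacketId =>
        ((∑ k ∈ Finset.range n, if Disjoint x (halfPeriod W₀ M k) then 0 else V : ℕ) : ℝ))
        = fun x => ∑ k ∈ Finset.range n,
          ((V : ℝ) + (-V) * if Disjoint x (halfPeriod W₀ M k) then 1 else 0) := by
      funext x
      rw [Nat.cast_sum]
      refine Finset.sum_congr rfl fun k _ => ?_
      split_ifs <;> simp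
    rw [hfun, subsetMean_sum, Finset.sum_congr rfl hk]
    simp
  rw [hmean]
  unfold subsetMean
  rw [ENNReal.ofReal_sum_of_nonneg fun x _ =>
    mul_nonneg (weight_nonneg h0 h1 _ _) (Nat.cast_nonneg _)]
  refine Finset.sum_le_sum fun x _ => ?_
  rw [ENNReal.ofReal_mul (weight_nonneg h0 h1 _ _), ENNReal.ofReal_natCast]
  exact mul_le_mul_right (le_optThroughput hW₀ hb n x) _

end Offline

/-! ### Randomized online algorithms -/

/-- Superadditivity of the lower integral needs no measurability, so that of the throughput in `ω`
need not be established. -/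
theorem sum_lintegral_le_lintegral_sum {Ω ι : Type*} [MeasurableSpace Ω] (P : Measure Ω)
    (I : Finset ι) (f : ι → Ω → ℝ≥0∞) :
    ∑ i ∈ I, ∫⁻ ω, f i ω ∂P ≤ ∫⁻ ω, ∑ i ∈ I, f i ω ∂P := by
  classical
  induction I using Finset.induction_on with
  | empty => simp
  | insert i I hi ih =>
    simp only [Finset.sum_insert hi]
    exact (add_le_add_right ih _).trans (le_lintegral_add _ _)

theorem le_of_forall_nat_mul_le {a b d : ℝ} (h : ∀ n : ℕ, n * a ≤ n * b + d) : a ≤ b := by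
  by_contra! hab
  obtain ⟨n, hn⟩ := exists_nat_gt (d / (a - b))
  rw [div_lt_iff₀ (sub_pos.2 hab)] at hn
  have := h n
  linarith

theorem RandomizedAlgorithm.le_competitiveRatio {Ω : Type*} [MeasurableSpace Ω] (P : Measure Ω)
    [IsProbabilityMeasure P] {W₀ W V M B b : ℕ} (hW₀ : 1 ≤ W₀) (hW₀W : W₀ ≤ W) (hW : 2 ≤ W)
    (hV : 1 ≤ V) (hb : 1 ≤ b) (hnonuniform : W₀ < W ∨ 1 < V) (A : RandomizedAlgorithm Ω) :
    ENNReal.ofReal ((V : ℝ) * ((W : ℝ) - 1) / (2 * (W₀ : ℝ)) *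
        (1 - (1 - 1 / ((V : ℝ) * ((W : ℝ) - 1) + 1 - (W₀ : ℝ))) ^ (M * W₀)))
      ≤ A.competitiveRatio P W₀ W V M B b := by
  -- Non-uniformity enters here: it gives `D ≥ 1`, so that `p = 1 / D` is a probability.
  have hD : W₀ ≤ V * (W - 1) := by
    rcases hnonuniform with h | h
    · calc W₀ ≤ 1 * (W - 1) := by omega
        _ ≤ _ := Nat.mul_le_mul_right _ hV
    · calc W₀ ≤ 2 * (W - 1) := by omega
        _ ≤ _ := Nat.mul_le_mul_right _ h
  have hD' : (W₀ : ℝ) ≤ V * ((W : ℝ) - 1) := by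
    rw [← Nat.cast_one, ← Nat.cast_sub (by omega)]; exact_mod_cast hD
  have hW' : (0 : ℝ) < (W : ℝ) - 1 := by
    have : (2 : ℝ) ≤ W := by exact_mod_cast hW
    linarith
  have hW₀' : (0 : ℝ) < W₀ := by exact_mod_cast hW₀
  set D : ℝ := (V : ℝ) * ((W : ℝ) - 1) + 1 - W₀ with hDdef
  have hD1 : 1 ≤ D := by linarith
  set p : ℝ := 1 / D with hpdef
  have h0 : 0 ≤ p := by positivity
  have h1 : p ≤ 1 := by rw [hpdef, div_le_one (by linarith)]; exact hD1
  have hp : p * D = 1 := by rw [hpdef]; field_simp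
  refine le_sInf fun c hc => ?_
  rcases eq_or_ne c ⊤ with rfl | hctop
  · exact le_top
  have hbound : ∀ n : ℕ, (n : ℝ) * (V * (1 - (1 - p) ^ (M * W₀)))
      ≤ c.toReal * (((2 * W₀ * n : ℕ) : ℝ) / ((W : ℝ) - 1) + B * V) := by
    intro n
    set S := Finset.range (2 * W₀ * n) ×ˢ Finset.range M with hS
    have hENN : ENNReal.ofReal (n * (V * (1 - (1 - p) ^ (M * W₀))))
        ≤ c * ENNReal.ofReal (((2 * W₀ * n : ℕ) : ℝ) / ((W : ℝ) - 1) + B * V) := by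
      calc _ ≤ _ := le_sum_optThroughput (W := W) (V := V) (M := M) hW₀ hb h0 h1 n
        _ ≤ ∑ x ∈ S.powerset, ENNReal.ofReal (p ^ x.card * (1 - p) ^ (S.card - x.card)) *
            (c * A.expectedThroughput P B (twoValued W₀ W V M (2 * W₀ * n) x)) :=
            Finset.sum_le_sum fun x _ => mul_le_mul_right
              (hc _ (admissible_twoValued hW₀W hV)) _
        _ = c * ∑ x ∈ S.powerset, ∫⁻ ω,
            ENNReal.ofReal (p ^ x.card * (1 - p) ^ (S.card - x.card)) *
            onlineThroughput B (twoValued W₀ W V M (2 * W₀ * n) x) (A.alg ω) ∂P := by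
            rw [Finset.mul_sum]
            refine Finset.sum_congr rfl fun x _ => ?_
            rw [lintegral_const_mul' _ _ ENNReal.ofReal_ne_top, mul_left_comm]
            rfl
        _ ≤ c * ∫⁻ ω, ∑ x ∈ S.powerset,
            ENNReal.ofReal (p ^ x.card * (1 - p) ^ (S.card - x.card)) *
            onlineThroughput B (twoValued W₀ W V M (2 * W₀ * n) x) (A.alg ω) ∂P :=
            mul_le_mul_right (sum_lintegral_le_lintegral_sum P _ _) _
        _ ≤ c * ∫⁻ _, ENNReal.ofReal (((2 * W₀ * n : ℕ) : ℝ) / ((W : ℝ) - 1) + B * V) ∂P :=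
            mul_le_mul_right (lintegral_mono fun ω =>
              sum_onlineThroughput_le hD hW₀ hW hV h0 h1 hp B (A.alg ω)) _
        _ = _ := by simp
    rw [← ENNReal.ofReal_toReal hctop, ← ENNReal.ofReal_mul ENNReal.toReal_nonneg] at hENN
    exact (ENNReal.ofReal_le_ofReal_iff (by positivity)).1 hENN
  rw [← ENNReal.ofReal_toReal hctop]
  refine ENNReal.ofReal_le_ofReal ?_
  -- The buffer term `B * V` does not depend on the number `n` of periods, so it disappears in the
  -- limit.
  have hlim : V * (1 - (1 - p) ^ (M * W₀)) ≤ c.toReal * (2 * W₀ / ((W : ℝ) - 1)) := by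
    refine le_of_forall_nat_mul_le (d := c.toReal * (B * V)) fun n => (hbound n).trans_eq ?_
    push_cast
    ring
  rw [← mul_div_assoc, le_div_iff₀ hW'] at hlim
  rw [div_mul_eq_mul_div, div_le_iff₀ (by positivity)]
  linarith

end Buffering

theorem theorem1 {Ω : Type*} [MeasurableSpace Ω] (P : Measure Ω) [IsProbabilityMeasure P]
    (W₀ W V M B : ℕ) (hW₀ : 1 ≤ W₀) (hW₀W : W₀ ≤ W) (hW : 2 ≤ W) (hV : 1 ≤ V) (hM : 1 ≤ M)
    (hB : 2 ≤ B)
    -- traffic is non-uniform: works or profits can differ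
    (hnonuniform : W₀ < W ∨ 1 < V)
    (A : Buffering.RandomizedAlgorithm Ω) :
    -- an offline optimum with a buffer for a single packet
    ENNReal.ofReal ((V : ℝ) * ((W : ℝ) - 1) / (2 * (W₀ : ℝ)) *
        (1 - (1 - 1 / ((V : ℝ) * ((W : ℝ) - 1) + 1 - (W₀ : ℝ))) ^ (M * W₀)))
      ≤ A.competitiveRatio P W₀ W V M B 1 ∧
    -- an offline optimum with a buffer of the same size as that of the online algorithm
    ENNReal.ofReal ((V : ℝ) * ((W : ℝ) - 1) / (2 * (W₀ : ℝ)) *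
        (1 - (1 - 1 / ((V : ℝ) * ((W : ℝ) - 1) + 1 - (W₀ : ℝ))) ^ (M * W₀)))
      ≤ A.competitiveRatio P W₀ W V M B B :=
  ⟨A.le_competitiveRatio P hW₀ hW₀W hW hV le_rfl hnonuniform,
    A.le_competitiveRatio P hW₀ hW₀W hW hV (by omega) hnonuniform⟩
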